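/- Let $M\ge 1$ and $N=3M$, and let $\eta_\alpha=\exp(2\pi i\alpha/N)$, $\alpha=1,\dots,N$, be the sites of a periodic chain on the unit circle. Each site carries one SU(3) spin in the fundamental representation, with colors blue (b), red (r) and green (g), so that the state space is $(\mathbb{C}^3)^{\otimes N}$. Let $e_\alpha^{\sigma\tau}$ be the operator that replaces the color $\tau$ at site $\alpha$ by $\sigma$ and annihilates every basis configuration whose color at $\alpha$ is not $\tau$. Let $J_\alpha^a=\frac12\sum_{\sigma,\tau}\lambda^a_{\sigma\tau}e_\alpha^{\sigma\tau}$, $a=1,\dots,8$, with the Gell-Mann matrices $\lambda^a$, and let $\boldsymbol J_\alpha\cdot\boldsymbol J_\beta=\sum_{a=1}^8 J^a_\alpha J^a_\beta$. The SU(3) Haldane–Shastry Hamiltonian is $$H_{\mathrm{SU}(3)}=\Big(\frac{2\pi}{N}\Big)^2\sum_{1\le\alpha<\beta\le N}\frac{\boldsymbol J_\alpha\cdot\boldsymbol J_\beta}{|\eta_\alpha-\eta_\beta|^2}.$$ Let $$\Psi_0[z_i;w_k]=\prod_{1\le i<j\le M}(z_i-z_j)^2\prod_{1\le k<l\le M}(w_k-w_l)^2\prod_{i=1}^M\prod_{k=1}^M(z_i-w_k)\prod_{i=1}^Mz_i\prod_{k=1}^Mw_k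 ,$$ $$|\Psi_0\rangle=\sum_{\{z_i,w_k\}}\Psi_0[z_i;w_k]\;e^{\mathrm{bg}}_{z_1}\cdots e^{\mathrm{bg}}_{z_M}\,e^{\mathrm{rg}}_{w_1}\cdots e^{\mathrm{rg}}_{w_M}\,|0_{\mathrm g}\rangle ,$$ where $|0_{\mathrm g}\rangle$ is the configuration in which all sites are green, and the sum runs over all ways to distribute the positions of $M$ blue particles $z_1,\dots,z_M$ and $M$ red particles $w_1,\dots,w_M$ over distinct sites of the chain (a site $\eta_\alpha$ is written as a subscript for its index $\alpha$). Then: 1. $|\Psi_0\rangle$ is a nonzero eigenvector of $H_{\mathrm{SU}(3)}$ with eigenvalue (energy) $$E_0=-\frac{\pi^2}{18}\Big(N+\frac7N\Big).$$ 2. The total momentum $p$ of $\Psi_0$, defined modulo $2\pi$ by $e^{ip}=\Psi_0[\eta_1z_i;\eta_1w_k]/\Psi_0[z_i;w_k]$, is $p=0$: for all pairwise distinct lattice positions $z_1,\dots,z_M,w_1,\dots,w_M$ one has $\Psi_0[z_i;w_k]\ne0$, and this quotient equals $1$. -/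

import Mathlib

namespace HaldaneShastrySU3

noncomputable section

/-- The three colors, in the order in which the Gell-Mann matrices refer to them:
`0` is blue, `1` is red, `2` is green. -/
abbrev Color : Type := Fin 3

abbrev blue : Color := 0
abbrev red : Color := 1
abbrev green : Color := 2

/-- States of the chain with `N` sites and exactly one SU(3) spin (in the fundamental
representation) on each site, i.e. of the space `(ℂ³)^{⊗ N}`, in the basis of the color
configurations `s : Fin N → Color`: `ψ s` is the amplitude of the configuration `s`. -/
abbrev SpinState (N : ℕ) : Type := (Fin N → Color) → ℂ

/-- The position `exp (2πi α / N)` of the site `α = 1, …, N` on the unit circle. The sites are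
indexed by `Fin N`, whose element `j` stands for `α = j + 1`. -/
def eta (N : ℕ) (j : Fin N) : ℂ :=
  Complex.exp (2 * Real.pi * Complex.I * ((j : ℕ) + 1) / N)

/-- `η₁ = exp (2πi / N)`. -/
def eta1 (N : ℕ) : ℂ := Complex.exp (2 * Real.pi * Complex.I / N)

/-- The colorflip operator `e_α^{στ}`: it annihilates a particle of color `τ` at the site `α` and
creates one of color `σ` there. A configuration with color `τ` at `α` is sent to the one with
`τ` replaced by `σ`, all other configurations are sent to `0`. -/
def colorFlip {N : ℕ} (α : Fin N) (σ τ : Color) : Module.End ℂ (SpinState N) where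
  toFun ψ s := if s α = σ then ψ (Function.update s α τ) else 0
  map_add' φ ψ := by
    funext s
    by_cases h : s α = σ <;> simp [h]
  map_smul' c ψ := by
    funext s
    by_cases h : s α = σ <;> simp [h]

/-- The Gell-Mann matrices `λ¹, …, λ⁸` (the index `a : Fin 8` stands for `a + 1`). -/
def gellMann : Fin 8 → Matrix Color Color ℂ :=
  ![!![0, 1, 0; 1, 0, 0; 0, 0, 0],
    !![0, -Complex.I, 0; Complex.I, 0, 0; 0, 0, 0],
    !![1, 0, 0; 0, -1, 0; 0, 0, 0],
    !![0, 0, 1; 0, 0, 0; 1, 0, 0],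
    !![0, 0, -Complex.I; 0, 0, 0; Complex.I, 0, 0],
    !![0, 0, 0; 0, 0, 1; 0, 1, 0],
    !![0, 0, 0; 0, 0, -Complex.I; 0, Complex.I, 0],
    ((1 / Real.sqrt 3 : ℝ) : ℂ) • !![1, 0, 0; 0, 1, 0; 0, 0, -2]]

/-- The component `J_α^a = ½ ∑_{στ} λ^a_{στ} e_α^{στ}` of the SU(3) spin at the site `α`. -/
def spin {N : ℕ} (α : Fin N) (a : Fin 8) : Module.End ℂ (SpinState N) :=
  (1 / 2 : ℂ) • ∑ σ : Color, ∑ τ : Color, gellMann a σ τ • colorFlip α σ τ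

/-- The product `J_α · J_β`. -/
def spinDot {N : ℕ} (α β : Fin N) : Module.End ℂ (SpinState N) :=
  ∑ a : Fin 8, spin α a * spin β a

/-- The Hamiltonian of the SU(3) Haldane-Shastry model,
`(2π/N)² ∑_{α<β} J_α · J_β / |η_α - η_β|²`. -/
def hamiltonian (N : ℕ) : Module.End ℂ (SpinState N) :=
  (((2 * Real.pi / N) ^ 2 : ℝ) : ℂ) •
    ∑ α : Fin N, ∑ β ∈ Finset.Ioi α,
      ((1 / ‖eta N α - eta N β‖ ^ 2 : ℝ) : ℂ) • spinDot α β

/-- The wave function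
`∏_{i<j} (z_i - z_j)² ∏_{k<l} (w_k - w_l)² ∏_{i,k} (z_i - w_k) ∏_i z_i ∏_k w_k`. -/
def psi0 {M₁ M₂ : ℕ} (z : Fin M₁ → ℂ) (w : Fin M₂ → ℂ) : ℂ :=
  (∏ i : Fin M₁, ∏ j ∈ Finset.Ioi i, (z i - z j) ^ 2) *
    (∏ k : Fin M₂, ∏ l ∈ Finset.Ioi k, (w k - w l) ^ 2) *
    (∏ i : Fin M₁, ∏ k : Fin M₂, (z i - w k)) *
    (∏ i : Fin M₁, z i) * (∏ k : Fin M₂, w k)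

/-- The reference state `|0_g⟩` in which all sites are green. -/
def greenState (N : ℕ) : SpinState N := Pi.single (fun _ => green) 1

/-- `e_{x_1}^{σg} ⋯ e_{x_M}^{σg}`. -/
def createAt {N M : ℕ} (σ : Color) (x : Fin M → Fin N) : Module.End ℂ (SpinState N) :=
  (List.ofFn fun i => colorFlip (x i) σ green).prod

open Classical in
/-- The state
`∑_{{z_i, w_k}} Ψ[z_i; w_k] e_{z_1}^{bg} ⋯ e_{z_{M₁}}^{bg} e_{w_1}^{rg} ⋯ e_{w_{M₂}}^{rg} |0_g⟩`
of the chain with `N` sites that belongs to a wave function `Ψ`. The sum runs over all ways to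
distribute `M₁` blue and `M₂` red particles over distinct sites; a set of sites is listed in
increasing order. -/
def stateOf (N : ℕ) {M₁ M₂ : ℕ} (Ψ : (Fin M₁ → ℂ) → (Fin M₂ → ℂ) → ℂ) : SpinState N :=
  ∑ x : Fin M₁ → Fin N, ∑ y : Fin M₂ → Fin N,
    if StrictMono x ∧ StrictMono y ∧ ∀ i k, x i ≠ y k then
      Ψ (fun i => eta N (x i)) (fun k => eta N (y k)) •
        (createAt blue x * createAt red y) (greenState N)
    else 0

/-- The wave function `Ψ` has total momentum `p` (modulo `2π`) on the chain with `N` sites: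
`e^{ip} = Ψ[η₁ z_i; η₁ w_k] / Ψ[z_i; w_k]` for all placements of the particles on distinct
sites, the quotient being a genuine one. -/
def HasMomentum (N : ℕ) {M₁ M₂ : ℕ} (Ψ : (Fin M₁ → ℂ) → (Fin M₂ → ℂ) → ℂ) (p : ℝ) : Prop :=
  ∀ (x : Fin M₁ → Fin N) (y : Fin M₂ → Fin N),
    Function.Injective x → Function.Injective y → (∀ i k, x i ≠ y k) →
      Ψ (fun i => eta N (x i)) (fun k => eta N (y k)) ≠ 0 ∧
        Complex.exp (Complex.I * p) =
          Ψ (fun i => eta1 N * eta N (x i)) (fun k => eta1 N * eta N (y k)) /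
            Ψ (fun i => eta N (x i)) (fun k => eta N (y k))

end

end HaldaneShastrySU3

namespace HaldaneShastrySU3

open Polynomial Finset

/-! ### The lattice of roots of unity -/

/-! By Gell-Mann completeness `J_α · J_β` is half the exchange of two colors minus `1/6`
(`spinDot_apply`). So the eigenvalue equation at a configuration `s` asks that the sum of `coupling
N i j` times the amplitude quotient under the exchange of `i` and `j` not depend on `s`
(`sum_coupling_exchange`).

The quotient is given by one formula, `exchangeRatio`, in which green plays no special role
(`amplitude_swap`). This rests on `η_i ∏_{j≠i} (η_i - η_j) = N`, which trades the product over one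
color for the products over the other two. Hence any color can serve as background. Exchanging `i`
with the sites of another color `c` becomes the hopping of one particle in the background `c`,
described by the values of a polynomial of degree at most `N` that vanishes at the remaining
occupied sites (`hopPoly`).

On such polynomials the inverse-square hopping sum acts as a second-order differential operator in
`x d/dx` (`sum_coupling_mul_eval`). Evaluating it through logarithmic derivatives leaves sums of
`cotan` and `coupling` over the sites of each color (`sum_coupling_mul_exchangeRatio`).

Summed over `i`, the squares of cotangent sums contain three-body terms. The cyclic identity
`cotan_cyclic` reduces these to constants and two-body sums of `coupling` between sites of equal
color, and the latter cancel against those already present.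

Nonvanishing holds because distinct sites have distinct nonzero coordinates. The momentum follows
from homogeneity: the degree `3M² = NM` is a multiple of `N`. -/

theorem isPrimitiveRoot_eta1 {N : ℕ} (hN : N ≠ 0) : IsPrimitiveRoot (eta1 N) N :=
  Complex.isPrimitiveRoot_exp N hN

theorem eta_eq_pow (N : ℕ) (j : Fin N) : eta N j = eta1 N ^ ((j : ℕ) + 1) := by
  rw [eta, eta1, ← Complex.exp_nat_mul]
  congr 1
  push_cast
  ring

theorem eta_ne_zero (N : ℕ) (j : Fin N) : eta N j ≠ 0 := Complex.exp_ne_zero _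

theorem eta_pow_card (N : ℕ) (j : Fin N) : eta N j ^ N = 1 := by
  have hN : N ≠ 0 := by rintro rfl; exact j.elim0
  rw [eta_eq_pow, ← pow_mul, mul_comm, pow_mul, (isPrimitiveRoot_eta1 hN).pow_eq_one, one_pow]

theorem eta_injective (N : ℕ) : Function.Injective (eta N) := by
  intro i j h
  have hN : N ≠ 0 := by rintro rfl; exact i.elim0
  rw [eta_eq_pow, eta_eq_pow, pow_succ, pow_succ] at h
  have h0 : eta1 N ≠ 0 := Complex.exp_ne_zero _
  exact Fin.ext ((isPrimitiveRoot_eta1 hN).pow_inj i.2 j.2 (mul_right_cancel₀ h0 h))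

theorem eta_sub_ne_zero {N : ℕ} {i j : Fin N} (h : i ≠ j) : eta N i - eta N j ≠ 0 :=
  sub_ne_zero.2 fun h' => h (eta_injective N h')

theorem image_eta {N : ℕ} (hN : N ≠ 0) : univ.image (eta N) = nthRootsFinset N (1 : ℂ) := by
  apply eq_of_subset_of_card_le
  · intro x hx
    obtain ⟨j, -, rfl⟩ := mem_image.1 hx
    exact (mem_nthRootsFinset (Nat.pos_of_ne_zero hN) 1).2 (eta_pow_card N j)
  · rw [(isPrimitiveRoot_eta1 hN).card_nthRootsFinset, card_image_of_injective _ (eta_injective N),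
      card_univ, Fintype.card_fin]

theorem sum_eta_div {N : ℕ} (i : Fin N) (g : ℂ → ℂ) :
    ∑ j, g (eta N j / eta N i) = ∑ x ∈ nthRootsFinset N (1 : ℂ), g x := by
  have hN : N ≠ 0 := by rintro rfl; exact i.elim0
  have hpos := Nat.pos_of_ne_zero hN
  rw [← sum_image (s := univ) (f := fun x => g (x / eta N i)) (g := eta N)
    (fun a _ b _ h => eta_injective N h), image_eta hN]
  refine sum_bij' (fun x _ => x / eta N i) (fun x _ => x * eta N i) ?_ ?_ ?_ ?_ ?_
  · intro x hx
    rw [mem_nthRootsFinset hpos] at hx ⊢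
    rw [div_pow, hx, eta_pow_card, div_one]
  · intro x hx
    rw [mem_nthRootsFinset hpos] at hx ⊢
    rw [mul_pow, hx, eta_pow_card, one_mul]
  · intro x _
    exact div_mul_cancel₀ _ (eta_ne_zero N i)
  · intro x _
    exact mul_div_cancel_right₀ _ (eta_ne_zero N i)
  · intro x _
    rfl

theorem sum_roots_inv {N : ℕ} (hN : N ≠ 0) (g : ℂ → ℂ) :
    ∑ x ∈ nthRootsFinset N (1 : ℂ), g x⁻¹ = ∑ x ∈ nthRootsFinset N (1 : ℂ), g x := by
  have hpos := Nat.pos_of_ne_zero hN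
  refine sum_bij' (fun x _ => x⁻¹) (fun x _ => x⁻¹) ?_ ?_ ?_ ?_ ?_
  · intro x hx
    rw [mem_nthRootsFinset hpos] at hx ⊢
    rw [inv_pow, hx, inv_one]
  · intro x hx
    rw [mem_nthRootsFinset hpos] at hx ⊢
    rw [inv_pow, hx, inv_one]
  all_goals intro x _; simp

theorem one_mem_roots {N : ℕ} (hN : N ≠ 0) : (1 : ℂ) ∈ nthRootsFinset N (1 : ℂ) :=
  (mem_nthRootsFinset (Nat.pos_of_ne_zero hN) 1).2 (one_pow N)

theorem sum_roots_pow {N m : ℕ} (h0 : 0 < m) (hm : m < N) :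
    ∑ x ∈ nthRootsFinset N (1 : ℂ), x ^ m = 0 := by
  have hN : N ≠ 0 := by omega
  have hζ := isPrimitiveRoot_eta1 hN
  have h1 : eta1 N ^ m ≠ 1 := fun h => hζ.pow_ne_one_of_pos_of_lt h0.ne' hm h
  have hpos := Nat.pos_of_ne_zero hN
  have key : eta1 N ^ m * ∑ x ∈ nthRootsFinset N (1 : ℂ), x ^ m =
      ∑ x ∈ nthRootsFinset N (1 : ℂ), x ^ m := by
    rw [mul_sum]
    refine sum_bij' (fun x _ => eta1 N * x) (fun x _ => (eta1 N)⁻¹ * x) ?_ ?_ ?_ ?_ ?_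
    · intro x hx
      rw [mem_nthRootsFinset hpos] at hx ⊢
      rw [mul_pow, hx, hζ.pow_eq_one, one_mul]
    · intro x hx
      rw [mem_nthRootsFinset hpos] at hx ⊢
      rw [mul_pow, hx, inv_pow, hζ.pow_eq_one, inv_one, one_mul]
    · intro x _
      exact inv_mul_cancel_left₀ (hζ.ne_zero hN) x
    · intro x _
      exact mul_inv_cancel_left₀ (hζ.ne_zero hN) x
    · intro x _
      rw [mul_pow]
  have : (eta1 N ^ m - 1) * ∑ x ∈ nthRootsFinset N (1 : ℂ), x ^ m = 0 := by
    rw [sub_mul, key, one_mul, sub_self]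
  exact (mul_eq_zero.1 this).resolve_left (sub_ne_zero.2 h1)

/-! ### Power sums over the roots of unity weighted by the inverse square distance -/

/-- The inverse square distance `-x / (1 - x)²` of a point `x` of the unit circle from `1`. -/
noncomputable def invSq (x : ℂ) : ℂ := -x / (1 - x) ^ 2

theorem invSq_one : invSq 1 = 0 := by simp [invSq]

theorem invSq_inv {x : ℂ} (hx : x ≠ 0) : invSq x⁻¹ = invSq x := by
  by_cases h1 : x = 1
  · simp [h1]
  have h2 : 1 - x ≠ 0 := sub_ne_zero.2 (Ne.symm h1)
  have h3 : x - 1 ≠ 0 := sub_ne_zero.2 h1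
  unfold invSq
  have h4 : 1 - x⁻¹ = (x - 1) / x := by field_simp
  rw [h4]
  field_simp
  ring

theorem sum_roots_erase {N : ℕ} (hN : N ≠ 0) (g : ℂ → ℂ) :
    ∑ x ∈ nthRootsFinset N (1 : ℂ), (if x = 1 then 0 else g x) =
      ∑ x ∈ nthRootsFinset N (1 : ℂ), g x - g 1 := by
  rw [← add_sum_erase _ _ (one_mem_roots hN), ← add_sum_erase _ g (one_mem_roots hN)]
  rw [if_pos rfl, zero_add, add_sub_cancel_left]
  exact sum_congr rfl fun x hx => if_neg (ne_of_mem_erase hx)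

/-- For `x ≠ 1` one has `(x + x⁻¹ - 2) * invSq x = -1`, and `x` and `x⁻¹` contribute equally by the
symmetry of `invSq`. -/
theorem sum_roots_pow_mul_invSq_one {N : ℕ} (hN : N ≠ 0) :
    ∑ x ∈ nthRootsFinset N (1 : ℂ), x * invSq x =
      ∑ x ∈ nthRootsFinset N (1 : ℂ), invSq x - (N - 1) / 2 := by
  have h1 : ∑ x ∈ nthRootsFinset N (1 : ℂ), x⁻¹ * invSq x =
      ∑ x ∈ nthRootsFinset N (1 : ℂ), x * invSq x := by
    rw [← sum_roots_inv hN]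
    refine sum_congr rfl fun x hx => ?_
    have hx0 : x ≠ 0 := ne_zero_of_mem_nthRootsFinset one_ne_zero hx
    rw [inv_inv, invSq_inv hx0]
  have h2 : ∑ x ∈ nthRootsFinset N (1 : ℂ), (x + x⁻¹ - 2) * invSq x = -(N - 1) := by
    have : ∀ x ∈ nthRootsFinset N (1 : ℂ), (x + x⁻¹ - 2) * invSq x =
        if x = 1 then 0 else -1 := by
      intro x hx
      have hx0 : x ≠ 0 := ne_zero_of_mem_nthRootsFinset one_ne_zero hx
      split_ifs with h
      · rw [h, invSq_one, mul_zero]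
      · have h2 : 1 - x ≠ 0 := sub_ne_zero.2 (Ne.symm h)
        unfold invSq
        field_simp
        ring
    rw [sum_congr rfl this, sum_roots_erase hN, sum_const,
      (isPrimitiveRoot_eta1 hN).card_nthRootsFinset, nsmul_eq_mul]
    ring
  simp only [sub_mul, add_mul, sum_sub_distrib, sum_add_distrib, h1, ← mul_sum] at h2
  linear_combination h2 / 2

/-- As a function of `m` the left side has constant second difference `1`: the factor `(x - 1)²`
cancels the denominator, and `-x ^ (m + 1)` summed over `x ≠ 1` gives `1` as long as `m + 1 < N`.
The values at `0` and `1` then determine it. -/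
theorem sum_roots_pow_mul_invSq {N : ℕ} (hN : N ≠ 0) (m : ℕ) (hm : m ≤ N) :
    ∑ x ∈ nthRootsFinset N (1 : ℂ), x ^ m * invSq x =
      ∑ x ∈ nthRootsFinset N (1 : ℂ), invSq x - m * (N - m) / 2 := by
  induction m using Nat.strong_induction_on with
  | _ m ih =>
    match m, ih, hm with
    | 0, _, _ => simp
    | 1, _, _ => simpa using sum_roots_pow_mul_invSq_one hN
    | m + 2, ih, hm =>
      have i0 := ih m (by omega) (by omega)
      have i1 := ih (m + 1) (by omega) (by omega)
      have h2 : ∑ x ∈ nthRootsFinset N (1 : ℂ),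
          (x ^ (m + 2) - 2 * x ^ (m + 1) + x ^ m) * invSq x = 1 := by
        have : ∀ x ∈ nthRootsFinset N (1 : ℂ),
            (x ^ (m + 2) - 2 * x ^ (m + 1) + x ^ m) * invSq x =
              if x = 1 then 0 else -x ^ (m + 1) := by
          intro x hx
          split_ifs with h
          · rw [h, invSq_one, mul_zero]
          · have h2 : 1 - x ≠ 0 := sub_ne_zero.2 (Ne.symm h)
            unfold invSq
            field_simp
            ring
        rw [sum_congr rfl this, sum_roots_erase hN, sum_neg_distrib,
          sum_roots_pow (by omega) (by omega)]
        simp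
      simp only [sub_mul, add_mul, sum_sub_distrib, sum_add_distrib, mul_assoc, ← mul_sum] at h2
      rw [i0, i1] at h2
      push_cast at h2 ⊢
      linear_combination h2

/-- Summing the previous formula over a full period of exponents kills the left side, since
geometric sums vanish at every root other than `1` and `invSq 1 = 0`. What remains is a linear
equation for the unknown sum. -/
theorem sum_roots_invSq {N : ℕ} (hN : N ≠ 0) :
    ∑ x ∈ nthRootsFinset N (1 : ℂ), invSq x = ((N : ℂ) ^ 2 - 1) / 12 := by
  have h : ∑ m ∈ range N, ∑ x ∈ nthRootsFinset N (1 : ℂ), x ^ m * invSq x = 0 := by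
    rw [sum_comm]
    refine sum_eq_zero fun x hx => ?_
    rw [← sum_mul]
    by_cases h1 : x = 1
    · rw [h1, invSq_one, mul_zero]
    · rw [geom_sum_eq h1, (mem_nthRootsFinset (Nat.pos_of_ne_zero hN) 1).1 hx, sub_self, zero_div,
        zero_mul]
  rw [sum_congr rfl fun m hm =>
    sum_roots_pow_mul_invSq hN m (mem_range.1 hm).le] at h
  -- The length `n` is decoupled from the `N` in the summand so that induction applies.
  have h3 : ∀ n : ℕ, ∑ m ∈ range n, ((m : ℂ) * (N - m) / 2) =
      n * (n - 1) / 4 * N - n * (n - 1) * (2 * n - 1) / 12 := by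
    intro n
    induction n with
    | zero => simp
    | succ n ih =>
      rw [sum_range_succ, ih]
      push_cast
      ring
  rw [sum_sub_distrib, h3, sum_const, card_range, nsmul_eq_mul] at h
  have hN' : (N : ℂ) ≠ 0 := Nat.cast_ne_zero.2 hN
  apply mul_left_cancel₀ hN'
  linear_combination h

/-! ### Couplings and cotangents between lattice sites -/

/-- `1 / |η_i - η_j|²`. -/
noncomputable def coupling (N : ℕ) (i j : Fin N) : ℂ := ((1 / ‖eta N i - eta N j‖ ^ 2 : ℝ) : ℂ)

theorem coupling_eq_div (N : ℕ) (i j : Fin N) :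
    coupling N i j = -(eta N i * eta N j) / (eta N i - eta N j) ^ 2 := by
  by_cases h : i = j
  · simp [coupling, h]
  have h1 := eta_sub_ne_zero h
  have hi := eta_ne_zero N i
  have hj := eta_ne_zero N j
  have hc : ∀ k, (starRingEnd ℂ) (eta N k) = (eta N k)⁻¹ := by
    intro k
    have hN : N ≠ 0 := by rintro rfl; exact k.elim0
    exact (Complex.inv_eq_conj (Complex.norm_eq_one_of_pow_eq_one (eta_pow_card N k) hN)).symm
  have h2 : ((‖eta N i - eta N j‖ : ℂ)) ^ 2 =
      -(eta N i - eta N j) ^ 2 / (eta N i * eta N j) := by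
    rw [← Complex.mul_conj', map_sub, hc, hc]
    field_simp
    ring
  rw [coupling]
  push_cast
  rw [h2, one_div_div, neg_div, div_neg]

theorem coupling_eq_invSq (N : ℕ) (i j : Fin N) :
    coupling N i j = invSq (eta N j / eta N i) := by
  rw [coupling_eq_div, invSq]
  have hi := eta_ne_zero N i
  by_cases h : i = j
  · simp [h, eta_ne_zero]
  have h1 := eta_sub_ne_zero h
  have h2 : 1 - eta N j / eta N i = (eta N i - eta N j) / eta N i := by field_simp
  rw [h2]
  field_simp

theorem coupling_self (N : ℕ) (i : Fin N) : coupling N i i = 0 := by simp [coupling]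

theorem coupling_comm (N : ℕ) (i j : Fin N) : coupling N i j = coupling N j i := by
  rw [coupling, coupling, norm_sub_rev]

theorem sum_coupling {N : ℕ} (i : Fin N) :
    ∑ j, coupling N i j = ((N : ℂ) ^ 2 - 1) / 12 := by
  have hN : N ≠ 0 := by rintro rfl; exact i.elim0
  simp only [coupling_eq_invSq]
  rw [sum_eta_div i invSq, sum_roots_invSq hN]

/-- `(η_i + η_j) / (η_i - η_j)`, which is `0` for `i = j`. -/
noncomputable def cotan (N : ℕ) (i j : Fin N) : ℂ := (eta N i + eta N j) / (eta N i - eta N j)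

theorem cotan_self (N : ℕ) (i : Fin N) : cotan N i i = 0 := by simp [cotan]

theorem cotan_comm (N : ℕ) (i j : Fin N) : cotan N i j = -cotan N j i := by
  rw [cotan, cotan, ← neg_sub (eta N j), div_neg, add_comm]

/-- The function `(1 + x) / (1 - x)` is odd under `x ↦ x⁻¹`, which permutes the roots of unity. -/
theorem sum_cotan {N : ℕ} (i : Fin N) : ∑ j, cotan N i j = 0 := by
  have hN : N ≠ 0 := by rintro rfl; exact i.elim0
  have h1 : ∀ j, cotan N i j = (fun x : ℂ => (1 + x) / (1 - x)) (eta N j / eta N i) := by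
    intro j
    have hi := eta_ne_zero N i
    have h2 : 1 - eta N j / eta N i = (eta N i - eta N j) / eta N i := by field_simp
    have h3 : 1 + eta N j / eta N i = (eta N i + eta N j) / eta N i := by field_simp
    simp only [h2, h3, cotan]
    rw [div_div_div_cancel_right₀ hi]
  rw [sum_congr rfl fun j _ => h1 j, sum_eta_div i fun x : ℂ => (1 + x) / (1 - x)]
  have h2 := sum_roots_inv hN (fun x : ℂ => (1 + x) / (1 - x))
  have h3 : ∀ x ∈ nthRootsFinset N (1 : ℂ), (1 + x⁻¹) / (1 - x⁻¹) = -((1 + x) / (1 - x)) := by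
    intro x hx
    have hx0 : x ≠ 0 := ne_zero_of_mem_nthRootsFinset one_ne_zero hx
    have e2 : 1 - x⁻¹ = (x - 1) / x := by field_simp
    have e3 : 1 + x⁻¹ = (x + 1) / x := by field_simp
    rw [e2, e3, div_div_div_cancel_right₀ hx0, ← neg_sub x, div_neg, neg_neg, add_comm]
  rw [sum_congr rfl h3, sum_neg_distrib] at h2
  linear_combination -h2 / 2

theorem cotan_mul_self {N : ℕ} {i j : Fin N} (h : i ≠ j) :
    cotan N i j * cotan N i j = 1 - 4 * coupling N i j := by
  rw [coupling_eq_div, cotan]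
  have h1 := eta_sub_ne_zero h
  field_simp
  ring

/-- This is the cotangent addition formula for three angles with sum zero; it is what reduces
three-body terms to constants. -/
theorem cotan_cyclic {N : ℕ} {i j k : Fin N} (hij : i ≠ j) (hik : i ≠ k) (hjk : j ≠ k) :
    cotan N i j * cotan N i k + cotan N j i * cotan N j k + cotan N k i * cotan N k j = 1 := by
  have h1 := eta_sub_ne_zero hij
  have h2 := eta_sub_ne_zero hik
  have h3 := eta_sub_ne_zero hjk
  rw [cotan_comm N j i, cotan_comm N k i, cotan_comm N k j]
  unfold cotan
  field_simp
  ring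

theorem prod_X_sub_eta {N : ℕ} (hN : N ≠ 0) :
    ∏ j, (X - C (eta N j)) = (X ^ N - 1 : ℂ[X]) := by
  rw [X_pow_sub_one_eq_prod (Nat.pos_of_ne_zero hN) (isPrimitiveRoot_eta1 hN), ← image_eta hN,
    prod_image fun a _ b _ h => eta_injective N h]

/-- The product is the derivative of `X ^ N - 1` at the root `η_i`. -/
theorem eta_mul_prod_eta_sub {N : ℕ} (i : Fin N) :
    eta N i * ∏ j ∈ univ.erase i, (eta N i - eta N j) = N := by
  have hN : N ≠ 0 := by rintro rfl; exact i.elim0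
  have h := congrArg (fun p => eval (eta N i) (derivative p)) (prod_X_sub_eta hN)
  rw [← mul_prod_erase univ _ (mem_univ i)] at h
  simp [eval_prod] at h
  rw [h, derivative_X_pow, eval_mul, eval_pow, eval_X, eval_C, mul_left_comm, mul_pow_sub_one hN,
    eta_pow_card, mul_one]

/-! ### The hopping sum of a polynomial -/

/-- The Euler operator `x d/dx`. -/
noncomputable def euler (p : ℂ[X]) : ℂ[X] := X * derivative p

/-- By linearity it suffices to treat monomials, where `-m (N - m) / 2 = (m² - N m) / 2` and `m` is
the eigenvalue of `euler`. The degree bound is the range in which the power sums have this quadratic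
form. -/
theorem sum_coupling_mul_eval {N : ℕ} (i : Fin N) (p : ℂ[X]) (hp : p.natDegree ≤ N) :
    ∑ j, coupling N i j * p.eval (eta N j) =
      ((N : ℂ) ^ 2 - 1) / 12 * p.eval (eta N i) +
        ((euler (euler p)).eval (eta N i) - N * (euler p).eval (eta N i)) / 2 := by
  have hN : N ≠ 0 := by rintro rfl; exact i.elim0
  have hi := eta_ne_zero N i
  have e1 : (euler p).eval (eta N i) =
      ∑ m ∈ range (N + 1), p.coeff m * ((m : ℂ) * eta N i ^ m) := by
    conv_lhs => rw [p.as_sum_range' (N + 1) (by omega)]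
    simp only [euler, derivative_sum, mul_sum, eval_finsetSum]
    refine sum_congr rfl fun m _ => ?_
    rcases m with _ | m <;> simp
    ring
  have e2 : (euler (euler p)).eval (eta N i) =
      ∑ m ∈ range (N + 1), p.coeff m * ((m : ℂ) ^ 2 * eta N i ^ m) := by
    conv_lhs => rw [p.as_sum_range' (N + 1) (by omega)]
    simp only [euler, derivative_sum, mul_sum, eval_finsetSum]
    refine sum_congr rfl fun m _ => ?_
    rcases m with _ | m <;> simp
    rcases m with _ | m <;> simp
    ring
  rw [e1, e2, eval_eq_sum_range' (Nat.lt_succ_of_le hp)]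
  simp only [eval_eq_sum_range' (Nat.lt_succ_of_le hp), mul_sum]
  rw [sum_comm, ← sum_sub_distrib, sum_div, ← sum_add_distrib]
  refine sum_congr rfl fun m hm => ?_
  have hm' : m ≤ N := Nat.lt_succ_iff.1 (mem_range.1 hm)
  have h1 : ∀ j, coupling N i j * (p.coeff m * eta N j ^ m) =
      p.coeff m * eta N i ^ m *
        (fun x => x ^ m * invSq x) (eta N j / eta N i) := by
    intro j
    simp only [coupling_eq_invSq, div_pow]
    field_simp
  rw [sum_congr rfl fun j _ => h1 j, ← mul_sum,
    sum_eta_div i fun x => x ^ m * invSq x,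
    sum_roots_pow_mul_invSq hN m hm', sum_roots_invSq hN]
  ring

/-- `L` is the logarithmic derivative `x p'/p` at `x`, and `E` is its Euler derivative. -/
def HasLogEuler (p : ℂ[X]) (x L E : ℂ) : Prop :=
  (euler p).eval x = L * p.eval x ∧ (euler (euler p)).eval x = (L ^ 2 + E) * p.eval x

theorem hasLogEuler_one (x : ℂ) : HasLogEuler 1 x 0 0 := by simp [HasLogEuler, euler]

theorem HasLogEuler.mul {p q : ℂ[X]} {x L E L' E' : ℂ} (hp : HasLogEuler p x L E)
    (hq : HasLogEuler q x L' E') : HasLogEuler (p * q) x (L + L') (E + E') := by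
  have e1 : ∀ p q, euler (p * q) = euler p * q + p * euler q := by
    intro p q
    simp only [euler, derivative_mul]
    ring
  have e2 : ∀ p q, euler (p + q) = euler p + euler q := by
    intro p q
    simp only [euler, derivative_add]
    ring
  constructor
  · rw [e1, eval_add, eval_mul, eval_mul, eval_mul, hp.1, hq.1]
    ring
  · rw [e1, e2, e1, e1]
    simp only [eval_add, eval_mul, hp.1, hq.1, hp.2, hq.2]
    ring

theorem hasLogEuler_prod {ι : Type*} (s : Finset ι) (p : ι → ℂ[X]) (x : ℂ) (L E : ι → ℂ)
    (h : ∀ i ∈ s, HasLogEuler (p i) x (L i) (E i)) :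
    HasLogEuler (∏ i ∈ s, p i) x (∑ i ∈ s, L i) (∑ i ∈ s, E i) := by
  classical
  induction s using Finset.induction_on with
  | empty => exact hasLogEuler_one x
  | insert a s ha ih =>
    rw [prod_insert ha, sum_insert ha, sum_insert ha]
    exact (h a (mem_insert_self a s)).mul (ih fun i hi => h i (mem_insert_of_mem hi))

theorem hasLogEuler_X (x : ℂ) : HasLogEuler X x 1 0 := by simp [HasLogEuler, euler]

theorem hasLogEuler_X_sub_eta {N : ℕ} {i j : Fin N} (h : i ≠ j) :
    HasLogEuler (X - C (eta N j)) (eta N i) ((1 + cotan N i j) / 2) (coupling N i j) := by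
  have h1 := eta_sub_ne_zero h
  rw [coupling_eq_div, cotan]
  constructor
  · simp only [euler, derivative_sub, derivative_X, derivative_C, sub_zero, mul_one, eval_X,
      eval_sub, eval_C]
    field_simp
    ring
  · simp only [euler, derivative_sub, derivative_X, derivative_C, sub_zero, mul_one, eval_X,
      eval_sub, eval_C]
    field_simp
    ring

/-! ### The Hamiltonian in terms of color exchanges -/

/-- The completeness (Fierz) relation of the Gell-Mann matrices. -/
theorem sum_gellMann (σ τ σ' τ' : Color) :
    ∑ a, gellMann a σ τ * gellMann a σ' τ' =
      (if σ = τ' ∧ τ = σ' then 2 else 0) - (if σ = τ ∧ σ' = τ' then 2 / 3 else 0) := by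
  have h3 : ((Real.sqrt 3 : ℝ) : ℂ)⁻¹ * ((Real.sqrt 3 : ℝ) : ℂ)⁻¹ = 1 / 3 := by
    rw [← mul_inv, ← Complex.ofReal_mul, Real.mul_self_sqrt (by norm_num)]
    norm_num
  fin_cases σ <;> fin_cases τ <;> fin_cases σ' <;> fin_cases τ' <;>
    simp [gellMann, Fin.sum_univ_succ] 
  all_goals
    first
    | linear_combination h3
    | linear_combination 2 * h3
    | linear_combination 4 * h3
    | norm_num1

theorem colorFlip_apply {N : ℕ} (α : Fin N) (σ τ : Color) (ψ : SpinState N) (s : Fin N → Color) :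
    colorFlip α σ τ ψ s = if s α = σ then ψ (Function.update s α τ) else 0 := rfl

theorem spin_apply {N : ℕ} (α : Fin N) (a : Fin 8) (ψ : SpinState N) (s : Fin N → Color) :
    spin α a ψ s = 1 / 2 * ∑ τ, gellMann a (s α) τ * ψ (Function.update s α τ) := by
  simp [spin, LinearMap.sum_apply, Finset.sum_apply, colorFlip_apply]

theorem spinDot_apply {N : ℕ} {α β : Fin N} (h : α ≠ β) (ψ : SpinState N) (s : Fin N → Color) :
    spinDot α β ψ s = 1 / 2 * ψ (s ∘ Equiv.swap α β) - 1 / 6 * ψ s := by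
  have hs : s ∘ Equiv.swap α β = Function.update (Function.update s α (s β)) β (s α) := by
    funext γ
    by_cases h1 : γ = β
    · simp [h1]
    · by_cases h2 : γ = α
      · simp [h2, h]
      · simp [h1, h2, Equiv.swap_apply_of_ne_of_ne]
  have h1 : spinDot α β ψ s = ∑ τ, ∑ τ', (1 / 4 * ∑ a, gellMann a (s α) τ * gellMann a (s β) τ') *
      ψ (Function.update (Function.update s α τ) β τ') := by
    simp only [spinDot, LinearMap.sum_apply, Finset.sum_apply, Module.End.mul_apply, spin_apply,
      Function.update_of_ne h.symm, mul_sum, sum_mul]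
    rw [sum_comm]
    refine sum_congr rfl fun τ _ => ?_
    rw [sum_comm]
    refine sum_congr rfl fun τ' _ => sum_congr rfl fun a _ => ?_
    ring
  rw [h1, hs]
  simp only [sum_gellMann]
  have h2 : ∀ τ τ' : Color, (1 / 4 * ((if s α = τ' ∧ τ = s β then (2 : ℂ) else 0) -
      (if s α = τ ∧ s β = τ' then 2 / 3 else 0))) *
      ψ (Function.update (Function.update s α τ) β τ') =
      (if s β = τ then if s α = τ' then
        1 / 2 * ψ (Function.update (Function.update s α τ) β τ') else 0 else 0) -
      (if s α = τ then if s β = τ' then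
        1 / 6 * ψ (Function.update (Function.update s α τ) β τ') else 0 else 0) := by
    intro τ τ'
    simp only [eq_comm (a := τ) (b := s β)]
    split_ifs <;> first | tauto | ring
  rw [sum_congr rfl fun τ _ => sum_congr rfl fun τ' _ => h2 τ τ']
  simp [sum_sub_distrib]

theorem sum_Ioi_eq_half {N : ℕ} (f : Fin N → Fin N → ℂ) (hf : ∀ i j, f i j = f j i)
    (h0 : ∀ i, f i i = 0) :
    ∑ i, ∑ j ∈ Ioi i, f i j = 1 / 2 * ∑ i, ∑ j, f i j := by
  have h1 : ∑ i, ∑ j ∈ Ioi i, f i j = ∑ i, ∑ j, if i < j then f i j else 0 := by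
    refine sum_congr rfl fun i _ => ?_
    rw [← sum_filter]
    congr 1
    ext j
    simp
  have h2 : ∑ i, ∑ j, (if i < j then f i j else 0) = ∑ i, ∑ j, if j < i then f i j else 0 := by
    rw [sum_comm]
    refine sum_congr rfl fun i _ => sum_congr rfl fun j _ => ?_
    rw [hf]
  have h3 : ∑ i, ∑ j, f i j =
      ∑ i, ∑ j, (if i < j then f i j else 0) + ∑ i, ∑ j, if j < i then f i j else 0 := by
    rw [← sum_add_distrib]
    refine sum_congr rfl fun i _ => ?_
    rw [← sum_add_distrib]
    refine sum_congr rfl fun j _ => ?_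
    rcases lt_trichotomy i j with h | h | h
    · simp [h, h.not_gt]
    · simp [h, h0]
    · simp [h, h.not_gt]
  rw [h1, h3, ← h2]
  ring

/-! ### The amplitudes of the ground state -/

/-- The sites of color `c`. -/
def sites {N : ℕ} (s : Fin N → Color) (c : Color) : Finset (Fin N) := univ.filter fun i => s i = c

theorem mem_sites {N : ℕ} {s : Fin N → Color} {c : Color} {i : Fin N} :
    i ∈ sites s c ↔ s i = c := by simp [sites]

/-- `∏_{j ∈ S} (η_i - η_j)`. -/
noncomputable def vprod {N : ℕ} (S : Finset (Fin N)) (i : Fin N) : ℂ :=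
  ∏ j ∈ S, (eta N i - eta N j)

theorem vprod_ne_zero {N : ℕ} {S : Finset (Fin N)} {i : Fin N} (h : i ∉ S) : vprod S i ≠ 0 :=
  prod_ne_zero_iff.2 fun _ hj => eta_sub_ne_zero fun e => h (e ▸ hj)

theorem vprod_insert {N : ℕ} {S : Finset (Fin N)} {i a : Fin N} (h : a ∉ S) :
    vprod (insert a S) i = (eta N i - eta N a) * vprod S i := prod_insert h

theorem prod_sub_eta {N : ℕ} (S : Finset (Fin N)) (i : Fin N) :
    ∏ j ∈ S, (eta N j - eta N i) = (-1) ^ #S * vprod S i := by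
  rw [vprod, ← prod_const, ← prod_mul_distrib]
  exact prod_congr rfl fun j _ => by ring

/-- The wave function `psi0` as a function of the sets of blue and of red sites. -/
noncomputable def amplitude {N : ℕ} (Z W : Finset (Fin N)) : ℂ :=
  (∏ x ∈ Z, vprod (Z.erase x) x) * (∏ x ∈ W, vprod (W.erase x) x) *
    (∏ x ∈ Z, vprod W x) * (∏ x ∈ Z, eta N x) * ∏ x ∈ W, eta N x

theorem prod_vprod_insert {N : ℕ} {S : Finset (Fin N)} {a : Fin N} (ha : a ∉ S) :
    ∏ x ∈ insert a S, vprod ((insert a S).erase x) x =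
      (∏ x ∈ S, vprod (S.erase x) x) * ((-1) ^ #S * vprod S a ^ 2) := by
  rw [prod_insert ha, erase_insert ha]
  have h : ∀ x ∈ S, vprod ((insert a S).erase x) x =
      (eta N x - eta N a) * vprod (S.erase x) x := by
    intro x hx
    have hne : a ≠ x := fun e => ha (e ▸ hx)
    rw [erase_insert_of_ne hne, vprod_insert fun h => ha (mem_of_mem_erase h)]
  rw [prod_congr rfl h, prod_mul_distrib, prod_sub_eta]
  ring

/-- The sign depends only on the number of particles, so it cancels when a particle is moved from
one site to another. -/
theorem amplitude_insert_left {N : ℕ} {Z W : Finset (Fin N)} {a : Fin N} (ha : a ∉ Z) :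
    amplitude (insert a Z) W =
      amplitude Z W * (eta N a * (-1) ^ #Z * vprod Z a ^ 2 * vprod W a) := by
  rw [amplitude, amplitude, prod_vprod_insert ha, prod_insert ha, prod_insert ha]
  ring

theorem amplitude_insert_right {N : ℕ} {Z W : Finset (Fin N)} {b : Fin N} (hb : b ∉ W) :
    amplitude Z (insert b W) =
      amplitude Z W * (eta N b * (-1) ^ #W * vprod W b ^ 2 * ((-1) ^ #Z * vprod Z b)) := by
  have h : ∏ x ∈ Z, vprod (insert b W) x = (-1) ^ #Z * vprod Z b * ∏ x ∈ Z, vprod W x := by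
    rw [← prod_sub_eta, ← prod_mul_distrib]
    exact prod_congr rfl fun x _ => vprod_insert hb
  rw [amplitude, amplitude, prod_vprod_insert hb, h, prod_insert hb]
  ring

theorem amplitude_ne_zero {N : ℕ} {Z W : Finset (Fin N)} (h : Disjoint Z W) :
    amplitude Z W ≠ 0 := by
  have h1 : ∀ S : Finset (Fin N), ∏ x ∈ S, vprod (S.erase x) x ≠ 0 := fun S =>
    prod_ne_zero_iff.2 fun x _ => vprod_ne_zero (notMem_erase x S)
  have h2 : ∀ S : Finset (Fin N), ∏ x ∈ S, eta N x ≠ 0 := fun S =>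
    prod_ne_zero_iff.2 fun x _ => eta_ne_zero N x
  have h3 : ∏ x ∈ Z, vprod W x ≠ 0 :=
    prod_ne_zero_iff.2 fun x hx => vprod_ne_zero (disjoint_left.1 h hx)
  exact mul_ne_zero (mul_ne_zero (mul_ne_zero (mul_ne_zero (h1 Z) (h1 W)) h3) (h2 Z)) (h2 W)

theorem prod_Ioi_sq {M : ℕ} (z : Fin M → ℂ) :
    ∏ i : Fin M, ∏ j ∈ Ioi i, (z i - z j) ^ 2 =
      (∏ i : Fin M, ∏ _j ∈ Ioi i, (-1 : ℂ)) * ∏ i, ∏ j ∈ univ.erase i, (z i - z j) := by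
  have h := prod_prod_Ioi_mul_eq_prod_prod_off_diag (fun i j => z j - z i)
  simp only [compl_singleton] at h
  rw [← h, ← prod_mul_distrib]
  refine prod_congr rfl fun i _ => ?_
  rw [← prod_mul_distrib]
  exact prod_congr rfl fun j _ => by ring

theorem prod_erase_image {N M : ℕ} {x : Fin M → Fin N} (hx : Function.Injective x) :
    ∏ i, ∏ j ∈ univ.erase i, (eta N (x i) - eta N (x j)) =
      ∏ a ∈ univ.image x, vprod ((univ.image x).erase a) a := by
  rw [prod_image fun a _ b _ h => hx h]
  refine prod_congr rfl fun i _ => ?_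
  rw [vprod, ← image_erase hx, prod_image fun a _ b _ h => hx h]

theorem psi0_eta {N M : ℕ} {x y : Fin M → Fin N} (hx : Function.Injective x)
    (hy : Function.Injective y) :
    psi0 (fun i => eta N (x i)) (fun k => eta N (y k)) =
      amplitude (univ.image x) (univ.image y) := by
  rw [psi0, amplitude, prod_Ioi_sq fun i => eta N (x i), prod_Ioi_sq fun k => eta N (y k),
    prod_erase_image hx, prod_erase_image hy]
  -- Turning squares over unordered pairs into products over ordered pairs costs the same sign for
  -- both colors, because both have `M` particles.
  have h2 : (∏ i : Fin M, ∏ _j ∈ Ioi i, (-1 : ℂ)) * (∏ i : Fin M, ∏ _j ∈ Ioi i, (-1 : ℂ)) = 1 := by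
    rw [← prod_mul_distrib]
    refine prod_eq_one fun i _ => ?_
    rw [← prod_mul_distrib]
    exact prod_eq_one fun j _ => by norm_num
  have h3 : ∏ a ∈ univ.image x, vprod (univ.image y) a =
      ∏ i, ∏ k, (eta N (x i) - eta N (y k)) := by
    rw [prod_image fun a _ b _ h => hx h]
    refine prod_congr rfl fun i _ => ?_
    rw [vprod, prod_image fun a _ b _ h => hy h]
  have h4 : ∀ u : Fin M → Fin N, Function.Injective u →
      ∏ a ∈ univ.image u, eta N a = ∏ i, eta N (u i) := fun u hu =>
    prod_image fun a _ b _ h => hu h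
  rw [h3, h4 x hx, h4 y hy]
  linear_combination (∏ a ∈ univ.image x, vprod ((univ.image x).erase a) a) *
    (∏ a ∈ univ.image y, vprod ((univ.image y).erase a) a) *
    (∏ i, ∏ k, (eta N (x i) - eta N (y k))) * (∏ i, eta N (x i)) * (∏ i, eta N (y i)) * h2

open Classical in
theorem createAt_single {N M : ℕ} (σ : Color) (x : Fin M → Fin N) (hx : Function.Injective x)
    (t : Fin N → Color) (ht : ∀ i, t (x i) = green) :
    createAt σ x (Pi.single t 1) =
      Pi.single (fun j => if ∃ i, x i = j then σ else t j) 1 := by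
  induction M with
  | zero => simp [createAt]
  | succ M ih =>
    have h1 : createAt σ x = colorFlip (x 0) σ green * createAt σ fun i : Fin M => x i.succ := by
      simp [createAt, List.ofFn_succ]
    rw [h1, Module.End.mul_apply,
      ih (fun i => x i.succ) (hx.comp (Fin.succ_injective M)) fun i => ht i.succ]
    have h0 : ¬ ∃ i : Fin M, x i.succ = x 0 := by
      rintro ⟨i, hi⟩
      exact Fin.succ_ne_zero i (hx hi)
    funext s
    rw [colorFlip_apply, Pi.single_apply, Pi.single_apply, ← ite_and]
    congr 1
    simp only [eq_iff_iff, funext_iff]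
    constructor
    · rintro ⟨h2, h3⟩ j
      by_cases hj : j = x 0
      · rw [hj, h2, if_pos ⟨0, rfl⟩]
      · have := h3 j
        rw [Function.update_of_ne hj] at this
        rw [this]
        congr 1
        simp only [Fin.exists_fin_succ, Ne.symm hj, false_or]
    · intro h2
      refine ⟨by rw [h2, if_pos ⟨0, rfl⟩], fun j => ?_⟩
      by_cases hj : j = x 0
      · rw [hj, Function.update_self, if_neg h0, ht 0]
      · rw [Function.update_of_ne hj, h2]
        congr 1
        simp only [Fin.exists_fin_succ, Ne.symm hj, false_or]

theorem createAt_createAt_green {N M : ℕ} {x y : Fin M → Fin N} (hx : Function.Injective x)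
    (hy : Function.Injective y) (hxy : ∀ i k, x i ≠ y k) (s : Fin N → Color) :
    (createAt blue x * createAt red y) (greenState N) s =
      if univ.image x = sites s blue ∧ univ.image y = sites s red then 1 else 0 := by
  classical
  rw [Module.End.mul_apply, greenState, createAt_single red y hy _ fun _ => rfl,
    createAt_single blue x hx, Pi.single_apply]
  · congr 1
    simp only [eq_iff_iff, funext_iff, Finset.ext_iff, mem_image, mem_univ, true_and, mem_sites]
    constructor
    · intro h
      constructor
      · intro j
        rw [h j]
        split_ifs with h1 h2 <;> simp [h1, blue, red, green]
      · intro j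
        rw [h j]
        split_ifs with h1 h2
        · obtain ⟨i, rfl⟩ := h1
          simp only [blue, red, zero_ne_one, iff_false, not_exists]
          exact fun k hk => hxy i k hk.symm
        · simp [h2]
        · simp [h2, red, green]
    · rintro ⟨h1, h2⟩ j
      rw [if_congr (h1 j) rfl (if_congr (h2 j) rfl rfl)]
      generalize s j = c
      fin_cases c <;> rfl
  · intro i
    exact if_neg fun ⟨k, hk⟩ => hxy i k hk.symm

/-- The amplitude of the configuration `s`. -/
theorem stateOf_psi0_apply (N M : ℕ) (s : Fin N → Color) :
    stateOf N (psi0 (M₁ := M) (M₂ := M)) s =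
      if #(sites s blue) = M ∧ #(sites s red) = M then
        amplitude (sites s blue) (sites s red) else 0 := by
  classical
  have h1 : stateOf N (psi0 (M₁ := M) (M₂ := M)) s =
      ∑ x : Fin M → Fin N, ∑ y : Fin M → Fin N,
        if (StrictMono x ∧ univ.image x = sites s blue) ∧
          (StrictMono y ∧ univ.image y = sites s red) then
          amplitude (sites s blue) (sites s red) else 0 := by
    rw [stateOf]
    simp only [Finset.sum_apply]
    refine sum_congr rfl fun x _ => sum_congr rfl fun y _ => ?_
    by_cases h : StrictMono x ∧ StrictMono y ∧ ∀ i k, x i ≠ y k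
    · obtain ⟨hx, hy, hxy⟩ := h
      rw [if_pos ⟨hx, hy, hxy⟩, Pi.smul_apply,
        createAt_createAt_green hx.injective hy.injective hxy, smul_eq_mul, mul_ite, mul_one,
        mul_zero, psi0_eta hx.injective hy.injective]
      by_cases h2 : univ.image x = sites s blue ∧ univ.image y = sites s red
      · rw [if_pos h2, if_pos ⟨⟨hx, h2.1⟩, hy, h2.2⟩, h2.1, h2.2]
      · rw [if_neg h2, if_neg fun h3 => h2 ⟨h3.1.2, h3.2.2⟩]
    · rw [if_neg h, if_neg]
      · rfl
      rintro ⟨⟨hx, hx'⟩, hy, hy'⟩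
      refine h ⟨hx, hy, fun i k hik => ?_⟩
      have e1 : x i ∈ sites s blue := hx' ▸ mem_image_of_mem x (mem_univ i)
      have e2 : y k ∈ sites s red := hy' ▸ mem_image_of_mem y (mem_univ k)
      rw [mem_sites] at e1 e2
      rw [← hik, e1] at e2
      exact absurd e2 (by decide)
  have h2 : ∀ (S : Finset (Fin N)) (x : Fin M → Fin N), StrictMono x ∧ univ.image x = S →
      #S = M := by
    rintro S x ⟨hx, rfl⟩
    rw [card_image_of_injective _ hx.injective, card_univ, Fintype.card_fin]
  rw [h1]
  split_ifs with h
  -- A set has exactly one increasing enumeration, so the double sum collapses to a single term.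
  · have h3 : ∀ (S : Finset (Fin N)) (hS : #S = M) (x : Fin M → Fin N),
        (StrictMono x ∧ univ.image x = S) ↔ x = S.orderEmbOfFin hS := by
      intro S hS x
      constructor
      · rintro ⟨hx, hx'⟩
        exact orderEmbOfFin_unique hS (fun i => hx' ▸ mem_image_of_mem x (mem_univ i)) hx
      · rintro rfl
        exact ⟨(S.orderEmbOfFin hS).strictMono, image_orderEmbOfFin_univ S hS⟩
    simp only [h3 _ h.1, h3 _ h.2, ite_and]
    simp
  · refine sum_eq_zero fun x _ => sum_eq_zero fun y _ => if_neg fun h3 => ?_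
    exact h ⟨h2 _ x h3.1, h2 _ y h3.2⟩

/-! ### The effect of a color exchange on the amplitude -/

/-- `∏ (η_i - η_j)` over the sites `j ≠ i` of color `c`. -/
noncomputable def siteProd {N : ℕ} (s : Fin N → Color) (c : Color) (i : Fin N) : ℂ :=
  vprod ((sites s c).erase i) i

theorem siteProd_ne_zero {N : ℕ} (s : Fin N → Color) (c : Color) (i : Fin N) :
    siteProd s c i ≠ 0 := vprod_ne_zero (notMem_erase _ _)

theorem eta_mul_prod_siteProd {N : ℕ} (s : Fin N → Color) (i : Fin N) :
    eta N i * ∏ c, siteProd s c i = N := by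
  rw [← eta_mul_prod_eta_sub i, ← prod_fiberwise (univ.erase i) s]
  congr 1
  refine prod_congr rfl fun c _ => ?_
  rw [siteProd, vprod, sites, filter_erase]

theorem sites_swap_left {N : ℕ} {s : Fin N → Color} {i j : Fin N} (h : s i ≠ s j) :
    sites (s ∘ Equiv.swap i j) (s i) = insert j ((sites s (s i)).erase i) := by
  ext k
  simp only [mem_sites, Function.comp_apply, mem_insert, mem_erase]
  by_cases h1 : k = i
  · subst h1
    have : k ≠ j := fun e => h (e ▸ rfl)
    simp [h.symm, this]
  · by_cases h2 : k = j
    · simp [h2]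
    · simp [Equiv.swap_apply_of_ne_of_ne h1 h2, h1, h2]

theorem sites_swap_right {N : ℕ} {s : Fin N → Color} {i j : Fin N} (h : s i ≠ s j) :
    sites (s ∘ Equiv.swap i j) (s j) = insert i ((sites s (s j)).erase j) := by
  rw [Equiv.swap_comm, sites_swap_left h.symm]

theorem sites_swap_of_ne {N : ℕ} {s : Fin N → Color} {i j : Fin N} {c : Color} (hi : s i ≠ c)
    (hj : s j ≠ c) : sites (s ∘ Equiv.swap i j) c = sites s c := by
  ext k
  simp only [mem_sites, Function.comp_apply]
  by_cases h1 : k = i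
  · simp [h1, hi, hj]
  · by_cases h2 : k = j
    · simp [h2, hi, hj]
    · simp [Equiv.swap_apply_of_ne_of_ne h1 h2]

theorem card_sites_comp {N : ℕ} (s : Fin N → Color) (e : Equiv.Perm (Fin N)) (c : Color) :
    #(sites (s ∘ e) c) = #(sites s c) := by
  refine card_bij (fun k _ => e k) (fun k hk => ?_) (fun a _ b _ h => e.injective h)
    fun k hk => ⟨e.symm k, ?_, e.apply_symm_apply k⟩
  · rw [mem_sites] at hk ⊢
    exact hk
  · rw [mem_sites] at hk ⊢
    rwa [Function.comp_apply, e.apply_symm_apply]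

/-- The quotient of the amplitudes after and before the exchange of the colors of `i` and `j`. -/
noncomputable def exchangeRatio {N : ℕ} (s : Fin N → Color) (i j : Fin N) : ℂ :=
  siteProd s (s i) j * siteProd s (s j) i /
    (siteProd s (s j) j * siteProd s (s i) i * (eta N i - eta N j) ^ 2)

theorem exchangeRatio_comm {N : ℕ} (s : Fin N → Color) (i j : Fin N) :
    exchangeRatio s i j = exchangeRatio s j i := by
  rw [exchangeRatio, exchangeRatio]
  congr 1 <;> ring

/-- Removing the site `j` from the product over another color. -/
theorem siteProd_of_mem {N : ℕ} {s : Fin N → Color} {i j : Fin N} (h : s i ≠ s j) :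
    siteProd s (s j) i = (eta N i - eta N j) * vprod ((sites s (s j)).erase j) i := by
  rw [siteProd, erase_eq_of_notMem (by rwa [mem_sites]), ← vprod_insert (notMem_erase _ _),
    insert_erase (mem_sites.2 rfl)]

theorem siteProd_of_ne {N : ℕ} {s : Fin N → Color} {i : Fin N} {c : Color} (h : s i ≠ c) :
    siteProd s c i = vprod (sites s c) i := by
  rw [siteProd, erase_eq_of_notMem (by rwa [mem_sites])]

/-- For blue and red the quotient can be read off from the factors. If one color is green, the wave
function contains no product over green sites; `eta_mul_prod_siteProd` at `i` and at `j` brings it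
in and eliminates the third color together with the factors `η_i`, `η_j`. -/
theorem amplitude_swap_aux {N : ℕ} {s : Fin N → Color} {i j : Fin N}
    (h : (s i = blue ∧ s j = green) ∨ (s i = red ∧ s j = green) ∨ (s i = blue ∧ s j = red)) :
    amplitude (sites (s ∘ Equiv.swap i j) blue) (sites (s ∘ Equiv.swap i j) red) =
      exchangeRatio s i j * amplitude (sites s blue) (sites s red) := by
  have hne : s i ≠ s j := by
    rcases h with ⟨h1, h2⟩ | ⟨h1, h2⟩ | ⟨h1, h2⟩ <;> rw [h1, h2] <;> decide
  have hij : i ≠ j := fun e => hne (congrArg s e)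
  have hd := eta_sub_ne_zero hij
  have e1 := siteProd_of_mem hne
  have e2 := siteProd_of_mem hne.symm
  have li := eta_mul_prod_siteProd s i
  have lj := eta_mul_prod_siteProd s j
  rw [Fin.prod_univ_three] at li lj
  have p1 := siteProd_ne_zero s (s j) j
  have p2 := siteProd_ne_zero s (s i) i
  have f1 : insert i ((sites s (s i)).erase i) = sites s (s i) := insert_erase (mem_sites.2 rfl)
  have f2 : insert j ((sites s (s j)).erase j) = sites s (s j) := insert_erase (mem_sites.2 rfl)
  have n1 : i ∉ (sites s (s i)).erase i := notMem_erase _ _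
  have n2 : j ∉ (sites s (s j)).erase j := notMem_erase _ _
  have n3 : j ∉ (sites s (s i)).erase i := fun h => hne (mem_sites.1 (mem_of_mem_erase h)).symm
  have n4 : i ∉ (sites s (s j)).erase j := fun h => hne (mem_sites.1 (mem_of_mem_erase h))
  have w1 := sites_swap_left hne
  have w2 := sites_swap_right hne
  have q1 : siteProd s (s i) i = vprod ((sites s (s i)).erase i) i := rfl
  have q2 : siteProd s (s j) j = vprod ((sites s (s j)).erase j) j := rfl
  rw [exchangeRatio, div_mul_eq_mul_div, eq_div_iff (mul_ne_zero (mul_ne_zero p1 p2) (pow_ne_zero 2 hd))]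
  rcases h with ⟨h1, h2⟩ | ⟨h1, h2⟩ | ⟨h1, h2⟩
  · rw [h1] at w1 f1 n1 n3 q1 e2
    rw [h2] at e1
    have w3 : sites (s ∘ Equiv.swap i j) red = sites s red :=
      sites_swap_of_ne (by rw [h1]; decide) (by rw [h2]; decide)
    have r1 : siteProd s red i = vprod (sites s red) i := siteProd_of_ne (by rw [h1]; decide)
    have r2 : siteProd s red j = vprod (sites s red) j := siteProd_of_ne (by rw [h2]; decide)
    rw [h1, h2, w1, w3, amplitude_insert_left n3]
    have key : amplitude (sites s blue) (sites s red) =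
        amplitude (insert i ((sites s blue).erase i)) (sites s red) := by rw [f1]
    rw [key, amplitude_insert_left n1]
    rw [r1, q1] at li
    rw [r2, e2] at lj
    rw [e2, q1]
    linear_combination amplitude ((sites s blue).erase i) (sites s red) *
      (-1) ^ #((sites s blue).erase i) * vprod ((sites s blue).erase i) i *
      vprod ((sites s blue).erase i) j * (eta N j - eta N i) * (lj - li)
  · rw [h1] at w1 f1 n1 n3 q1 e2
    rw [h2] at e1
    have w3 : sites (s ∘ Equiv.swap i j) blue = sites s blue :=
      sites_swap_of_ne (by rw [h1]; decide) (by rw [h2]; decide)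
    have r1 : siteProd s blue i = vprod (sites s blue) i := siteProd_of_ne (by rw [h1]; decide)
    have r2 : siteProd s blue j = vprod (sites s blue) j := siteProd_of_ne (by rw [h2]; decide)
    rw [h1, h2, w1, w3, amplitude_insert_right n3]
    have key : amplitude (sites s blue) (sites s red) =
        amplitude (sites s blue) (insert i ((sites s red).erase i)) := by rw [f1]
    rw [key, amplitude_insert_right n1]
    rw [r1, q1] at li
    rw [r2, e2] at lj
    rw [e2, q1]
    linear_combination amplitude (sites s blue) ((sites s red).erase i) *
      (-1) ^ #((sites s red).erase i) * (-1) ^ #(sites s blue) * vprod ((sites s red).erase i) i *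
      vprod ((sites s red).erase i) j * (eta N j - eta N i) * (lj - li)
  · rw [h1] at w1 f1 n1 n3 q1 e2
    rw [h2] at e1 w2 f2 n2 n4 q2
    rw [h1, h2, w1, w2, amplitude_insert_left n3, amplitude_insert_right n4, vprod_insert n4]
    have key : amplitude (sites s blue) (sites s red) =
        amplitude (insert i ((sites s blue).erase i)) (insert j ((sites s red).erase j)) := by
      rw [f1, f2]
    rw [key, amplitude_insert_left n1, amplitude_insert_right n2, vprod_insert n2, e1, e2, q1, q2]
    ring

theorem amplitude_swap {N : ℕ} {s : Fin N → Color} {i j : Fin N} (hne : s i ≠ s j) :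
    amplitude (sites (s ∘ Equiv.swap i j) blue) (sites (s ∘ Equiv.swap i j) red) =
      exchangeRatio s i j * amplitude (sites s blue) (sites s red) := by
  have h : ((s i = blue ∧ s j = green) ∨ (s i = red ∧ s j = green) ∨ (s i = blue ∧ s j = red)) ∨
      ((s j = blue ∧ s i = green) ∨ (s j = red ∧ s i = green) ∨ (s j = blue ∧ s i = red)) := by
    generalize s i = a at hne ⊢
    generalize s j = b at hne ⊢
    revert a b
    decide
  rcases h with h | h
  · exact amplitude_swap_aux h
  · rw [Equiv.swap_comm, exchangeRatio_comm]
    exact amplitude_swap_aux h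

/-! ### Hopping sums in a configuration -/

/-- The sum of `cotan N i j` over the sites `j` of color `c`. -/
noncomputable def cotanSum {N : ℕ} (s : Fin N → Color) (c : Color) (i : Fin N) : ℂ :=
  ∑ j ∈ sites s c, cotan N i j

/-- The sum of `coupling N i j` over the sites `j` of color `c`. -/
noncomputable def couplingSum {N : ℕ} (s : Fin N → Color) (c : Color) (i : Fin N) : ℂ :=
  ∑ j ∈ sites s c, coupling N i j

theorem sum_sites {N : ℕ} (s : Fin N → Color) (f : Fin N → ℂ) :
    ∑ c, ∑ j ∈ sites s c, f j = ∑ j, f j := sum_fiberwise univ s f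

theorem sum_cotanSum {N : ℕ} (s : Fin N → Color) (i : Fin N) : ∑ c, cotanSum s c i = 0 := by
  rw [← sum_cotan i, ← sum_sites s]
  rfl

theorem sum_couplingSum {N : ℕ} (s : Fin N → Color) (i : Fin N) :
    ∑ c, couplingSum s c i = ((N : ℂ) ^ 2 - 1) / 12 := by
  rw [← sum_coupling i, ← sum_sites s]
  rfl

/-- The wave function as a polynomial in the coordinate of the particle at `i`, when `e` is the
color that is neither that of `i` nor that of the background. -/
noncomputable def hopPoly {N : ℕ} (s : Fin N → Color) (e : Color) (i : Fin N) : ℂ[X] :=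
  X * ((∏ j ∈ (sites s (s i)).erase i, (X - C (eta N j)) * (X - C (eta N j))) *
    ∏ j ∈ sites s e, (X - C (eta N j)))

theorem eval_hopPoly {N : ℕ} (s : Fin N → Color) (e : Color) (i j : Fin N) :
    (hopPoly s e i).eval (eta N j) =
      eta N j * (vprod ((sites s (s i)).erase i) j ^ 2 * vprod (sites s e) j) := by
  simp only [hopPoly, eval_mul, eval_X, eval_prod, eval_sub, eval_C, vprod, prod_mul_distrib]
  ring

/-- The degree is at most `1 + 2 (M - 1) + M = N - 1`. -/
theorem natDegree_hopPoly_le {N M : ℕ} (hN : N = 3 * M) {s : Fin N → Color}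
    (hs : ∀ c, #(sites s c) = M) (e : Color) (i : Fin N) : (hopPoly s e i).natDegree ≤ N := by
  have h1 : #((sites s (s i)).erase i) = M - 1 := by
    rw [card_erase_of_mem (mem_sites.2 rfl), hs]
  have hM : 1 ≤ M := by have := i.2; omega
  have hl : ∀ S : Finset (Fin N), (∏ j ∈ S, (X - C (eta N j))).natDegree = #S := by
    intro S
    rw [natDegree_prod_of_monic _ _ fun j _ => monic_X_sub_C _]
    simp
  have h2 := hl ((sites s (s i)).erase i)
  have h3 := hl (sites s e)
  rw [hopPoly, prod_mul_distrib]
  refine natDegree_mul_le.trans ?_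
  have h4 := natDegree_mul_le (p := (∏ j ∈ (sites s (s i)).erase i, (X - C (eta N j))) *
    ∏ j ∈ (sites s (s i)).erase i, (X - C (eta N j))) (q := ∏ j ∈ sites s e, (X - C (eta N j)))
  have h5 := natDegree_mul_le (p := ∏ j ∈ (sites s (s i)).erase i, (X - C (eta N j)))
    (q := ∏ j ∈ (sites s (s i)).erase i, (X - C (eta N j)))
  rw [natDegree_X]
  rw [h2] at h5
  rw [h3, hs] at h4
  omega

theorem sum_cotan_erase {N : ℕ} (s : Fin N → Color) (i : Fin N) (c : Color) :
    ∑ j ∈ (sites s c).erase i, cotan N i j = cotanSum s c i :=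
  sum_erase _ (cotan_self N i)

theorem sum_coupling_erase {N : ℕ} (s : Fin N → Color) (i : Fin N) (c : Color) :
    ∑ j ∈ (sites s c).erase i, coupling N i j = couplingSum s c i :=
  sum_erase _ (coupling_self N i)

theorem hasLogEuler_hopPoly {N M : ℕ} (hN : N = 3 * M) {s : Fin N → Color}
    (hs : ∀ c, #(sites s c) = M) {e : Color} {i : Fin N} (he : s i ≠ e) :
    HasLogEuler (hopPoly s e i) (eta N i) (N / 2 + cotanSum s (s i) i + cotanSum s e i / 2)
      (2 * couplingSum s (s i) i + couplingSum s e i) := by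
  have hM : 1 ≤ M := by have := i.2; omega
  have h1 := hasLogEuler_prod ((sites s (s i)).erase i)
    (fun j => (X - C (eta N j)) * (X - C (eta N j))) (eta N i)
    (fun j => (1 + cotan N i j) / 2 + (1 + cotan N i j) / 2)
    (fun j => coupling N i j + coupling N i j) fun j hj =>
      (hasLogEuler_X_sub_eta (ne_of_mem_erase hj).symm).mul
        (hasLogEuler_X_sub_eta (ne_of_mem_erase hj).symm)
  have h2 := hasLogEuler_prod (sites s e) (fun j => X - C (eta N j)) (eta N i)
    (fun j => (1 + cotan N i j) / 2) (fun j => coupling N i j) fun j hj =>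
      hasLogEuler_X_sub_eta fun h => he (h ▸ mem_sites.1 hj)
  have h3 := (hasLogEuler_X (eta N i)).mul (h1.mul h2)
  have c1 : ((#((sites s (s i)).erase i) : ℕ) : ℂ) = M - 1 := by
    rw [card_erase_of_mem (mem_sites.2 rfl), hs, Nat.cast_sub hM, Nat.cast_one]
  convert h3 using 1
  · rfl
  -- The constants add up to `1 + (M - 1) + M / 2 = N / 2`, which is the value that removes the
  -- linear term from `L ^ 2 - N * L`.
  · simp only [← sum_div, sum_add_distrib, sum_const, nsmul_eq_mul, c1, hs, sum_cotan_erase]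
    have hN' : (N : ℂ) = 3 * M := by rw [hN]; push_cast; ring
    rw [← cotanSum]
    linear_combination hN' / 2
  · rw [sum_add_distrib, sum_coupling_erase, ← couplingSum]
    ring

theorem eval_hopPoly_eq_exchangeRatio_mul {N : ℕ} {s : Fin N → Color} {e : Color} {i j : Fin N}
    (hij : s i ≠ s j) (he : s i ≠ e) (he' : s j ≠ e) :
    (hopPoly s e i).eval (eta N j) = exchangeRatio s i j * (hopPoly s e i).eval (eta N i) := by
  have hd := eta_sub_ne_zero fun h : i = j => hij (congrArg s h)
  have hu : ∀ k, eta N k * (siteProd s (s i) k * siteProd s (s j) k * siteProd s e k) = N := by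
    intro k
    rw [← eta_mul_prod_siteProd s k, Fin.prod_univ_three]
    congr 1
    generalize s i = a at hij he
    generalize s j = b at hij he'
    fin_cases a <;> fin_cases b <;> fin_cases e <;>
      first | exact absurd rfl hij | exact absurd rfl he | exact absurd rfl he' | skip
    all_goals simp only [Fin.reduceFinMk, Fin.zero_eta, Fin.mk_one]
    all_goals ring
  have li := hu i
  have lj := hu j
  have p1 := siteProd_ne_zero s (s j) j
  have p2 := siteProd_ne_zero s (s i) i
  have e2 := siteProd_of_mem hij.symm
  have q1 : vprod ((sites s (s i)).erase i) i = siteProd s (s i) i := rfl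
  rw [eval_hopPoly, eval_hopPoly, ← siteProd_of_ne he, ← siteProd_of_ne he', q1, exchangeRatio,
    div_mul_eq_mul_div, eq_div_iff (mul_ne_zero (mul_ne_zero p1 p2) (pow_ne_zero 2 hd))]
  rw [e2] at lj ⊢
  linear_combination vprod ((sites s (s i)).erase i) j * siteProd s (s i) i *
    (eta N j - eta N i) * (lj - li)

/-- Here `c` acts as the background. The polynomial `hopPoly s e i` vanishes at the sites of color
`e` and at the other sites of color `s i`, and the coupling vanishes at `i` itself, so the hopping
sum over all sites only sees color `c`. The sums over `e` are then eliminated by the total sums over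
the chain. -/
theorem sum_coupling_mul_exchangeRatio {N M : ℕ} (hN : N = 3 * M) {s : Fin N → Color}
    (hs : ∀ c, #(sites s c) = M) {c : Color} {i : Fin N} (hc : s i ≠ c) :
    ∑ j ∈ sites s c, coupling N i j * exchangeRatio s i j =
      ((N : ℂ) ^ 2 - 1) / 8 - (N : ℂ) ^ 2 / 8 +
        ((cotanSum s (s i) i - cotanSum s c i) ^ 2 / 4 + couplingSum s (s i) i -
          couplingSum s c i) / 2 := by
  obtain ⟨e, he, he', hsum⟩ : ∃ e, s i ≠ e ∧ c ≠ e ∧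
      ∀ f : Color → ℂ, ∑ x, f x = f (s i) + f c + f e := by
    simp only [Fin.sum_univ_three]
    generalize s i = a at hc ⊢
    fin_cases a <;> fin_cases c <;> simp at hc
    · exact ⟨2, by decide, by decide, fun f => rfl⟩
    · exact ⟨1, by decide, by decide, fun f => by simp; ring⟩
    · exact ⟨2, by decide, by decide, fun f => by simp; ring⟩
    · exact ⟨0, by decide, by decide, fun f => by simp; ring⟩
    · exact ⟨1, by decide, by decide, fun f => by simp; ring⟩
    · exact ⟨0, by decide, by decide, fun f => by simp; ring⟩
  have k1 := sum_cotanSum s i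
  have k2 := sum_couplingSum s i
  rw [hsum] at k1 k2
  have h0 : (hopPoly s e i).eval (eta N i) ≠ 0 := by
    rw [eval_hopPoly, ← siteProd_of_ne he]
    exact mul_ne_zero (eta_ne_zero N i)
      (mul_ne_zero (pow_ne_zero 2 (siteProd_ne_zero s _ i)) (siteProd_ne_zero s _ i))
  have hL := hasLogEuler_hopPoly hN hs he
  have h1 := sum_coupling_mul_eval i (hopPoly s e i) (natDegree_hopPoly_le hN hs e i)
  rw [hL.1, hL.2, ← sum_sites s, hsum] at h1
  have z : ∀ S : Finset (Fin N), ∀ j ∈ S, vprod S j = 0 := fun S j hj =>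
    prod_eq_zero hj (sub_self _)
  have z1 : ∑ j ∈ sites s (s i), coupling N i j * (hopPoly s e i).eval (eta N j) = 0 := by
    refine sum_eq_zero fun j hj => ?_
    by_cases h : j = i
    · rw [h, coupling_self, zero_mul]
    · rw [eval_hopPoly, z _ j (mem_erase.2 ⟨h, hj⟩)]
      ring
  have z2 : ∑ j ∈ sites s e, coupling N i j * (hopPoly s e i).eval (eta N j) = 0 := by
    refine sum_eq_zero fun j hj => ?_
    rw [eval_hopPoly, z _ j hj]
    ring
  have z3 : ∑ j ∈ sites s c, coupling N i j * (hopPoly s e i).eval (eta N j) =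
      (∑ j ∈ sites s c, coupling N i j * exchangeRatio s i j) *
        (hopPoly s e i).eval (eta N i) := by
    rw [sum_mul]
    refine sum_congr rfl fun j hj => ?_
    rw [mem_sites] at hj
    subst hj
    rw [eval_hopPoly_eq_exchangeRatio_mul hc he he', mul_assoc]
  rw [z1, z2, z3, zero_add, add_zero] at h1
  apply mul_right_cancel₀ h0
  rw [h1]
  have k3 : cotanSum s e i = -cotanSum s (s i) i - cotanSum s c i := by linear_combination k1
  have k4 : couplingSum s e i = ((N : ℂ) ^ 2 - 1) / 12 - couplingSum s (s i) i -
    couplingSum s c i := by linear_combination k2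
  rw [k3, k4]
  ring

/-! ### Three-body sums -/

/-- The value of the cyclic sum of products of two cotangents, with coincident sites allowed. -/
theorem sum_cotan_cyclic_of_subset {N : ℕ} (S : Finset (Fin N)) {j k : Fin N} (hjk : j ≠ k)
    (hj : j ∈ S) (hk : k ∈ S) :
    ∑ i ∈ S, (cotan N i j * cotan N i k + cotan N j i * cotan N j k + cotan N k i * cotan N k j) =
      #S - 8 * coupling N j k := by
  have hk' : k ∈ S.erase j := mem_erase.2 ⟨hjk.symm, hk⟩
  rw [← add_sum_erase S _ hj, ← add_sum_erase _ _ hk']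
  have h1 : ∀ i ∈ (S.erase j).erase k, cotan N i j * cotan N i k + cotan N j i * cotan N j k +
      cotan N k i * cotan N k j = 1 := by
    intro i hi
    obtain ⟨h1, h2⟩ := mem_erase.1 hi
    exact cotan_cyclic (mem_erase.1 h2).1 h1 hjk
  rw [sum_congr rfl h1, sum_const, nsmul_eq_mul, mul_one, card_erase_of_mem hk',
    card_erase_of_mem hj, Nat.sub_sub, Nat.cast_sub, cotan_self, cotan_self]
  -- At `i = j` and at `i = k` only one square of a cotangent survives; each contributes `1 - 4 *
  -- coupling N j k`.
  · have a1 := cotan_mul_self hjk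
    have a2 := cotan_mul_self hjk.symm
    rw [coupling_comm N k j] at a2
    push_cast
    linear_combination a1 + a2
  · exact one_lt_card.2 ⟨j, hj, k, hk, hjk⟩

theorem sum_cotan_cyclic_self {N : ℕ} (S : Finset (Fin N)) {j : Fin N} (hj : j ∈ S) :
    ∑ i ∈ S, (cotan N i j * cotan N i j + cotan N j i * cotan N j j + cotan N j i * cotan N j j) =
      #S - 1 - 4 * ∑ i ∈ S, coupling N j i := by
  rw [← add_sum_erase S _ hj, ← add_sum_erase S (fun i => coupling N j i) hj, cotan_self,
    coupling_self]
  have h1 : ∀ i ∈ S.erase j, cotan N i j * cotan N i j + cotan N j i * 0 +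
      cotan N j i * 0 = 1 - 4 * coupling N j i := by
    intro i hi
    rw [cotan_mul_self (ne_of_mem_erase hi), coupling_comm]
    ring
  rw [sum_congr rfl h1, sum_sub_distrib, sum_const, nsmul_eq_mul, card_erase_of_mem hj,
    Nat.cast_sub (card_pos.2 ⟨j, hj⟩), ← mul_sum]
  push_cast
  ring

/-- The cyclic sum over `i ∈ S`, `j, k ∈ T` for `T ⊆ S`. -/
theorem sum_cotan_cyclic {N : ℕ} {S T : Finset (Fin N)} (h : T ⊆ S) :
    ∑ j ∈ T, ∑ k ∈ T, ∑ i ∈ S,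
      (cotan N i j * cotan N i k + cotan N j i * cotan N j k + cotan N k i * cotan N k j) =
      #T * (#T * #S - 1) - 4 * ∑ j ∈ T, ∑ i ∈ S, coupling N j i -
        8 * ∑ j ∈ T, ∑ k ∈ T, coupling N j k := by
  have h1 : ∀ j ∈ T, ∑ k ∈ T, ∑ i ∈ S,
      (cotan N i j * cotan N i k + cotan N j i * cotan N j k + cotan N k i * cotan N k j) =
      (#T * #S - 1 - 4 * ∑ i ∈ S, coupling N j i) - 8 * ∑ k ∈ T, coupling N j k := by
    intro j hj
    rw [← add_sum_erase T _ hj, sum_cotan_cyclic_self S (h hj),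
      ← add_sum_erase T (fun k => coupling N j k) hj, coupling_self]
    have h2 : ∀ k ∈ T.erase j, ∑ i ∈ S, (cotan N i j * cotan N i k + cotan N j i * cotan N j k +
        cotan N k i * cotan N k j) = #S - 8 * coupling N j k := fun k hk =>
      sum_cotan_cyclic_of_subset S (ne_of_mem_erase hk).symm (h hj) (h (mem_of_mem_erase hk))
    rw [sum_congr rfl h2, sum_sub_distrib, sum_const, nsmul_eq_mul, card_erase_of_mem hj,
      Nat.cast_sub (card_pos.2 ⟨j, hj⟩), ← mul_sum]
    push_cast
    ring
  rw [sum_congr rfl h1]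
  simp only [sum_sub_distrib, sum_const, nsmul_eq_mul, ← mul_sum]
  ring

theorem sum_cotan_cyclic_eq {N : ℕ} (S T : Finset (Fin N)) :
    ∑ j ∈ T, ∑ k ∈ T, ∑ i ∈ S,
      (cotan N i j * cotan N i k + cotan N j i * cotan N j k + cotan N k i * cotan N k j) =
      ∑ i ∈ S, (∑ j ∈ T, cotan N i j) ^ 2 +
        2 * ∑ j ∈ T, (∑ i ∈ S, cotan N j i) * ∑ k ∈ T, cotan N j k := by
  simp only [sum_add_distrib]
  have h1 : ∑ j ∈ T, ∑ k ∈ T, ∑ i ∈ S, cotan N i j * cotan N i k =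
      ∑ i ∈ S, (∑ j ∈ T, cotan N i j) ^ 2 := by
    simp only [sq, sum_mul_sum]
    rw [sum_comm' (t' := T) (s' := fun _ => T) (by tauto)]
    rw [sum_congr rfl fun j _ => sum_comm, sum_comm]
    refine sum_congr rfl fun i _ => sum_comm
  have h2 : ∑ j ∈ T, ∑ k ∈ T, ∑ i ∈ S, cotan N j i * cotan N j k =
      ∑ j ∈ T, (∑ i ∈ S, cotan N j i) * ∑ k ∈ T, cotan N j k := by
    refine sum_congr rfl fun j _ => ?_
    rw [sum_mul_sum, sum_comm]
  have h3 : ∑ j ∈ T, ∑ k ∈ T, ∑ i ∈ S, cotan N k i * cotan N k j =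
      ∑ j ∈ T, (∑ i ∈ S, cotan N j i) * ∑ k ∈ T, cotan N j k := by
    rw [sum_comm, h2]
  rw [h1, h2, h3]
  ring

/-- With `i` running over the whole chain the mixed terms contain the full sum `sum_cotan` and drop
out. -/
theorem sum_cotanSum_sq {N M : ℕ} {s : Fin N → Color} {c : Color} (hs : #(sites s c) = M) :
    ∑ i, cotanSum s c i ^ 2 = M * (M * N - 1) - 4 * (M * (((N : ℂ) ^ 2 - 1) / 12)) -
      8 * ∑ i ∈ sites s c, couplingSum s c i := by
  have h := sum_cotan_cyclic_eq univ (sites s c)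
  rw [sum_cotan_cyclic (subset_univ _)] at h
  simp only [sum_cotan, sum_coupling, zero_mul, sum_const_zero, mul_zero, add_zero, hs, sum_const,
    card_univ, Fintype.card_fin, nsmul_eq_mul] at h
  exact h.symm

/-- With all three indices in the same set the three cyclic terms have equal sums, hence the factor
`3`. -/
theorem sum_cotanSum_sq_sites {N M : ℕ} {s : Fin N → Color} {c : Color} (hs : #(sites s c) = M) :
    3 * ∑ i ∈ sites s c, cotanSum s c i ^ 2 = M * (M * M - 1) -
      12 * ∑ i ∈ sites s c, couplingSum s c i := by
  have h := sum_cotan_cyclic_eq (sites s c) (sites s c)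
  rw [sum_cotan_cyclic subset_rfl, hs] at h
  simp only [← sq] at h
  simp only [couplingSum, cotanSum]
  linear_combination -h

/-- The configuration drops out: the two kinds of squares contribute `-(12 + 8) / 8 = -5 / 2` times
the equal-color couplings, against `5 / 2` from the hopping sums and the equal-color exchanges. -/
theorem sum_coupling_exchange {N M : ℕ} (hN : N = 3 * M) {s : Fin N → Color}
    (hs : ∀ c, #(sites s c) = M) :
    ∑ i, ∑ j, coupling N i j * (if s i = s j then 1 else exchangeRatio s i j) =
      -(N : ℂ) * ((N : ℂ) ^ 2 / 36 + 5 / 12) := by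
  have h1 : ∀ i, ∑ j, coupling N i j * (if s i = s j then 1 else exchangeRatio s i j) =
      ((N : ℂ) ^ 2 - 1) / 4 - (N : ℂ) ^ 2 / 4 - ((N : ℂ) ^ 2 - 1) / 24 +
        (3 * cotanSum s (s i) i ^ 2 + ∑ c, cotanSum s c i ^ 2) / 8 +
        5 / 2 * couplingSum s (s i) i := by
    intro i
    -- The hopping formula is extended to `c = s i`, where it reduces to its constant; the last term
    -- corrects this to the true value.
    have h2 : ∀ c, ∑ j ∈ sites s c,
        coupling N i j * (if s i = s j then 1 else exchangeRatio s i j) =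
        ((N : ℂ) ^ 2 - 1) / 8 - (N : ℂ) ^ 2 / 8 +
        ((cotanSum s (s i) i - cotanSum s c i) ^ 2 / 4 + couplingSum s (s i) i -
          couplingSum s c i) / 2 + if s i = c then couplingSum s (s i) i -
            (((N : ℂ) ^ 2 - 1) / 8 - (N : ℂ) ^ 2 / 8) else 0 := by
      intro c
      split_ifs with hc
      · subst hc
        have : ∀ j ∈ sites s (s i),
            coupling N i j * (if s i = s j then 1 else exchangeRatio s i j) =
              coupling N i j := by
          intro j hj
          rw [if_pos (mem_sites.1 hj).symm, mul_one]
        rw [sum_congr rfl this, couplingSum]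
        ring
      · rw [add_zero, ← sum_coupling_mul_exchangeRatio hN hs hc]
        refine sum_congr rfl fun j hj => ?_
        rw [if_neg]
        rwa [mem_sites.1 hj]
    rw [← sum_sites s, sum_congr rfl fun c _ => h2 c, sum_add_distrib, sum_ite_eq,
      if_pos (mem_univ _)]
    have k1 := sum_cotanSum s i
    have k2 := sum_couplingSum s i
    simp only [Fin.sum_univ_three] at k1 k2 ⊢
    linear_combination -cotanSum s (s i) i / 4 * k1 - k2 / 2
  have h3 : ∀ f : Color → Fin N → ℂ, ∑ i, f (s i) i = ∑ c, ∑ i ∈ sites s c, f c i := by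
    intro f
    rw [← sum_sites s]
    refine sum_congr rfl fun c _ => sum_congr rfl fun i hi => ?_
    rw [mem_sites.1 hi]
  rw [sum_congr rfl fun i _ => h1 i]
  simp only [sum_add_distrib, ← sum_div, ← mul_sum]
  rw [h3 fun c i => cotanSum s c i ^ 2, h3 fun c i => couplingSum s c i, sum_comm (s := univ),
    mul_sum, sum_congr rfl fun c _ => sum_cotanSum_sq_sites (hs c),
    sum_congr rfl fun c _ => sum_cotanSum_sq (hs c)]
  simp only [Fin.sum_univ_three, sum_const, card_univ, Fintype.card_fin, nsmul_eq_mul]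
  have hN' : (N : ℂ) = 3 * M := by rw [hN]; push_cast; ring
  rw [hN']
  ring

/-! ### The eigenvalue equation -/

theorem hamiltonian_apply (N : ℕ) (ψ : SpinState N) (s : Fin N → Color) :
    hamiltonian N ψ s = (2 * Real.pi / N) ^ 2 *
      (1 / 2 * ∑ i, ∑ j, coupling N i j *
        (1 / 2 * ψ (s ∘ Equiv.swap i j) - 1 / 6 * ψ s)) := by
  have h1 : hamiltonian N ψ s = (2 * Real.pi / N) ^ 2 * ∑ i, ∑ j ∈ Ioi i, coupling N i j *
        (1 / 2 * ψ (s ∘ Equiv.swap i j) - 1 / 6 * ψ s) := by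
    rw [hamiltonian, LinearMap.smul_apply, Pi.smul_apply, smul_eq_mul]
    push_cast
    simp only [Finset.sum_apply, LinearMap.smul_apply, Pi.smul_apply,
      smul_eq_mul]
    congr 1
    refine sum_congr rfl fun i _ => sum_congr rfl fun j hj => ?_
    rw [spinDot_apply (mem_Ioi.1 hj).ne, coupling]
    push_cast
    rfl
  rw [h1, sum_Ioi_eq_half]
  · intro i j
    rw [coupling_comm, Equiv.swap_comm]
  · intro i
    rw [coupling_self, zero_mul]

theorem card_sites_green {N M : ℕ} (hN : N = 3 * M) {s : Fin N → Color}
    (hs : #(sites s blue) = M ∧ #(sites s red) = M) (c : Color) : #(sites s c) = M := by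
  have h : ∑ c, #(sites s c) = N := by
    simpa [sites] using (card_eq_sum_card_fiberwise (f := s) (s := univ) (t := univ)
      fun _ _ => mem_univ _).symm
  rw [Fin.sum_univ_three] at h
  obtain ⟨h1, h2⟩ := hs
  fin_cases c
  · exact h1
  · exact h2
  · simp only [Fin.reduceFinMk]
    change #(sites s 0) = M at h1
    change #(sites s 1) = M at h2
    omega

theorem hamiltonian_stateOf_psi0 {N M : ℕ} (hM : 1 ≤ M) (hN : N = 3 * M) :
    hamiltonian N (stateOf N (psi0 (M₁ := M) (M₂ := M))) =
      ((-(Real.pi ^ 2 / 18) * ((N : ℝ) + 7 / (N : ℝ)) : ℝ) : ℂ) •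
        stateOf N (psi0 (M₁ := M) (M₂ := M)) := by
  funext s
  have hN0 : (N : ℂ) ≠ 0 := Nat.cast_ne_zero.2 (by omega)
  rw [hamiltonian_apply, Pi.smul_apply, smul_eq_mul]
  by_cases hs : #(sites s blue) = M ∧ #(sites s red) = M
  · have hψ : ∀ i j, stateOf N (psi0 (M₁ := M) (M₂ := M)) (s ∘ Equiv.swap i j) =
        (if s i = s j then 1 else exchangeRatio s i j) *
          stateOf N (psi0 (M₁ := M) (M₂ := M)) s := by
      intro i j
      split_ifs with h
      · rw [one_mul]
        congr 1
        funext k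
        rw [Function.comp_apply, Equiv.swap_apply_def]
        split_ifs with h1 h2
        · rw [h1, h]
        · rw [h2, h]
        · rfl
      · rw [stateOf_psi0_apply, stateOf_psi0_apply, if_pos hs, if_pos, amplitude_swap h]
        rwa [card_sites_comp, card_sites_comp]
    have h1 : ∑ i, ∑ j, coupling N i j *
        (1 / 2 * stateOf N (psi0 (M₁ := M) (M₂ := M)) (s ∘ Equiv.swap i j) -
          1 / 6 * stateOf N (psi0 (M₁ := M) (M₂ := M)) s) =
        (1 / 2 * ∑ i, ∑ j, coupling N i j * (if s i = s j then 1 else exchangeRatio s i j) -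
          1 / 6 * ∑ i, ∑ j, coupling N i j) * stateOf N (psi0 (M₁ := M) (M₂ := M)) s := by
      simp only [mul_sum, sum_mul, ← sum_sub_distrib]
      refine sum_congr rfl fun i _ => sum_congr rfl fun j _ => ?_
      rw [hψ]
      ring
    rw [h1, sum_coupling_exchange hN (card_sites_green hN hs)]
    simp only [sum_coupling, sum_const, card_univ, Fintype.card_fin, nsmul_eq_mul]
    push_cast
    field_simp
    ring
  -- Exchanges preserve the number of sites of each color, so outside the sector of the state both
  -- sides vanish.
  · have h0 : ∀ e : Equiv.Perm (Fin N),
        stateOf N (psi0 (M₁ := M) (M₂ := M)) (s ∘ e) = 0 := by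
      intro e
      rw [stateOf_psi0_apply, if_neg]
      rwa [card_sites_comp, card_sites_comp]
    have h1 : stateOf N (psi0 (M₁ := M) (M₂ := M)) s = 0 := h0 1
    simp [h0, h1]

/-! ### Nonvanishing of the state and its momentum -/

theorem disjoint_sites {N : ℕ} (s : Fin N → Color) : Disjoint (sites s blue) (sites s red) := by
  rw [disjoint_left]
  intro i h1 h2
  rw [mem_sites] at h1 h2
  rw [h1] at h2
  exact absurd h2 (by decide)

theorem stateOf_psi0_ne_zero {N M : ℕ} (hN : N = 3 * M) :
    stateOf N (psi0 (M₁ := M) (M₂ := M)) ≠ 0 := by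
  obtain ⟨Z, -, hZ⟩ := exists_subset_card_eq (s := (univ : Finset (Fin N))) (n := M)
    (by rw [card_univ, Fintype.card_fin]; omega)
  obtain ⟨W, hWZ, hW⟩ := exists_subset_card_eq (s := Zᶜ) (n := M)
    (by rw [card_compl, Fintype.card_fin, hZ]; omega)
  intro h
  set s : Fin N → Color := fun i => if i ∈ Z then blue else if i ∈ W then red else green with hs
  have h1 : sites s blue = Z := by
    ext i
    rw [mem_sites, hs]
    by_cases hi : i ∈ Z <;> by_cases hi' : i ∈ W <;> simp [hi, hi', blue, red, green]
  have h2 : sites s red = W := by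
    ext i
    rw [mem_sites, hs]
    by_cases hi' : i ∈ W
    · have hi : i ∉ Z := mem_compl.1 (hWZ hi')
      simp [hi, hi']
    · by_cases hi : i ∈ Z <;> simp [hi, hi', blue, red, green]
  have h3 := congrFun h s
  rw [stateOf_psi0_apply, if_pos ⟨h1 ▸ hZ, h2 ▸ hW⟩] at h3
  exact amplitude_ne_zero (disjoint_sites s) h3

theorem psi0_smul {M : ℕ} (a : ℂ) (z w : Fin M → ℂ) :
    psi0 (fun i => a * z i) (fun k => a * w k) = a ^ (3 * M * M) * psi0 z w := by
  have h1 : ∀ u : Fin M → ℂ, ∏ i : Fin M, ∏ j ∈ Ioi i, (a * u i - a * u j) ^ 2 =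
      a ^ (M * (M - 1)) * ∏ i : Fin M, ∏ j ∈ Ioi i, (u i - u j) ^ 2 := by
    intro u
    -- Applied to the constant `a`, the identity counts ordered pairs and so yields the exponent `M
    -- * (M - 1)`.
    have h2 := prod_prod_Ioi_mul_eq_prod_prod_off_diag (fun _ _ : Fin M => a)
    simp only [prod_const, card_compl, card_singleton, card_univ, Fintype.card_fin, ← pow_mul,
      mul_comm (M - 1)] at h2
    simp only [← mul_sub, mul_pow, sq a, prod_mul_distrib, prod_const]
    simp only [← h2, mul_pow, prod_mul_distrib]
  have h3 : ∏ i : Fin M, ∏ k : Fin M, (a * z i - a * w k) =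
      a ^ (M * M) * ∏ i : Fin M, ∏ k : Fin M, (z i - w k) := by
    simp only [← mul_sub, prod_mul_distrib, prod_const, card_univ, Fintype.card_fin, ← pow_mul]
  have h4 : 3 * M * M = M * (M - 1) + M * (M - 1) + M * M + M + M := by
    rcases M with _ | M
    · rfl
    · rw [Nat.add_sub_cancel]
      ring
  simp only [psi0, h1, h3, prod_mul_distrib, prod_const, card_univ, Fintype.card_fin]
  rw [h4, pow_add, pow_add, pow_add, pow_add]
  ring

theorem hasMomentum_psi0 {N M : ℕ} (hM : 1 ≤ M) (hN : N = 3 * M) :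
    HasMomentum N (psi0 (M₁ := M) (M₂ := M)) 0 := by
  intro x y hx hy hxy
  have h0 : psi0 (fun i => eta N (x i)) (fun k => eta N (y k)) ≠ 0 := by
    rw [psi0_eta hx hy]
    apply amplitude_ne_zero
    rw [disjoint_left]
    intro i h1 h2
    obtain ⟨a, -, rfl⟩ := mem_image.1 h1
    obtain ⟨b, -, hb⟩ := mem_image.1 h2
    exact hxy a b hb.symm
  refine ⟨h0, ?_⟩
  rw [psi0_smul, ← hN, pow_mul, (isPrimitiveRoot_eta1 (by omega)).pow_eq_one, one_pow, one_mul,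
    div_self h0]
  simp

end HaldaneShastrySU3

theorem mainTheorem5 (N M : ℕ) (hM : 1 ≤ M) (hN : N = 3 * M) :
    Module.End.HasEigenvector (HaldaneShastrySU3.hamiltonian N)
        ((-(Real.pi ^ 2 / 18) * ((N : ℝ) + 7 / (N : ℝ)) : ℝ) : ℂ)
        (HaldaneShastrySU3.stateOf N (HaldaneShastrySU3.psi0 (M₁ := M) (M₂ := M))) ∧
      HaldaneShastrySU3.HasMomentum N (HaldaneShastrySU3.psi0 (M₁ := M) (M₂ := M)) 0 :=
  ⟨Module.End.hasEigenvector_iff.2 ⟨Module.End.mem_eigenspace_iff.2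
    (HaldaneShastrySU3.hamiltonian_stateOf_psi0 hM hN),
    HaldaneShastrySU3.stateOf_psi0_ne_zero hN⟩,
    HaldaneShastrySU3.hasMomentum_psi0 hM hN⟩
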